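/- Let $A$ be a commutative normed $*$-algebra: a complex commutative associative algebra, not necessarily unital, with a norm satisfying $|ab|\le|a||b|$ (not necessarily complete) and a conjugate-linear involution $a\mapsto a^*$ with $(ab)^*=b^*a^*$ (not assumed continuous). Let $A_{sa}=\{a\in A: a^*=a\}$. A linear functional $\varphi:A\to\mathbb C$ is positive if $\varphi(a^*a)\ge 0$ for all $a\in A$. A positive linear functional $\varphi$ is weakly continuous on $A_{sa}$ if for each $b\in A$ the map $a\mapsto\varphi(b^*ab)$ is continuous on $A_{sa}$. It has finite variation if there is $v\ge 0$ with $|\varphi(a)|^2\le v\,\varphi(a^*a)$ for all $a\in A$, and the infimum of all such $v$ is then its variation. The set $S(A)$ of states on $A$ consists of the positive linear functionals on $A$ which are weakly continuous on $A_{sa}$ and have finite variation equal to $1$. Let $\Delta^*_{bsa}(A)$ be the set of non-zero linear functionals $\tau:A\to\mathbb C$ such that $\tau(ab)=\tau(a)\tau(b)$ and $\tau(a^*)=\overline{\tau(a)}$ for all $a,b\in A$, and such that $\tau$ is bounded on $A_{sa}$, i.e. $|\tau(a)|\le C|a|$ for all $a\in A_{sa}$ and some constant $C$. Equip it with the weak$^*$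 topology, i.e. the weakest topology for which the functions $\widehat a:\tau\mapsto\tau(a)$ $(a\in A_{sa})$ are continuous. Let $M_1(\Delta^*_{bsa}(A))$ be the set of inner regular Borel probability measures on $\Delta^*_{bsa}(A)$, that is, Borel probability measures $\mu$ with $\mu(\omega)=\sup\{\mu(K):K\subset\omega\text{ compact}\}$ for every Borel set $\omega$. For $a\in A$ write $\widehat a(\tau)=\tau(a)$. Then for every $\mu\in M_1(\Delta^*_{bsa}(A))$ each $\widehat a$ $(a\in A)$ is $\mu$-integrable, and the formula $$\psi(a)=\int\widehat a\,d\mu\qquad(a\in A)$$ establishes an affine bijection $\mu\mapsto\psi$ from $M_1(\Delta^*_{bsa}(A))$ onto $S(A)$. -/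

import Mathlib

open MeasureTheory
open scoped ComplexOrder NNReal

namespace AbstractBochner

/-- `φ` is a positive linear functional: `φ (a* a) ≥ 0` for all `a`. (In `ComplexOrder`, `0 ≤ z`
means that `z` is real and nonnegative.) -/
def IsPositive {A : Type*} [NonUnitalNormedCommRing A] [StarRing A] [NormedSpace ℂ A]
    (φ : A →ₗ[ℂ] ℂ) : Prop :=
  ∀ a : A, 0 ≤ φ (star a * a)

/-- `φ` is weakly continuous on the set `A_sa` of self-adjoint elements: for each `b`, the map
`a ↦ φ (b* a b)` is continuous on `A_sa`. -/
def IsWeaklyContinuousOnSA {A : Type*} [NonUnitalNormedCommRing A] [StarRing A] [NormedSpace ℂ A]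
    (φ : A →ₗ[ℂ] ℂ) : Prop :=
  ∀ b : A, Continuous fun a : selfAdjoint A => φ (star b * (a : A) * b)

/-- The set of constants `v ≥ 0` with `|φ a|² ≤ v φ (a* a)` for all `a`. -/
def variationBounds {A : Type*} [NonUnitalNormedCommRing A] [StarRing A] [NormedSpace ℂ A]
    (φ : A →ₗ[ℂ] ℂ) : Set ℝ :=
  {v : ℝ | 0 ≤ v ∧ ∀ a : A, ‖φ a‖ ^ 2 ≤ v * (φ (star a * a)).re}

/-- `φ` has finite variation. -/
def HasFiniteVariation {A : Type*} [NonUnitalNormedCommRing A] [StarRing A] [NormedSpace ℂ A]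
    (φ : A →ₗ[ℂ] ℂ) : Prop :=
  (variationBounds φ).Nonempty

/-- The variation of a positive linear functional of finite variation. -/
noncomputable def variation {A : Type*} [NonUnitalNormedCommRing A] [StarRing A] [NormedSpace ℂ A]
    (φ : A →ₗ[ℂ] ℂ) : ℝ :=
  sInf (variationBounds φ)

/-- The set `S(A)` of states: the positive linear functionals that are weakly continuous on `A_sa`
and have finite variation, equal to `1`. -/
def States (A : Type*) [NonUnitalNormedCommRing A] [StarRing A] [NormedSpace ℂ A] :
    Set (A →ₗ[ℂ] ℂ) :=
  {φ | IsPositive φ ∧ IsWeaklyContinuousOnSA φ ∧ HasFiniteVariation φ ∧ variation φ = 1}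

/-- The space `Δ*_bsa(A)` of Hermitian multiplicative (hence nonzero) linear functionals on `A`
that are bounded on `A_sa`. -/
structure BsaCharacter (A : Type*) [NonUnitalNormedCommRing A] [StarRing A]
    [NormedSpace ℂ A] where
  /-- the underlying linear functional -/
  toLin : A →ₗ[ℂ] ℂ
  ne_zero : toLin ≠ 0
  map_mul : ∀ a b : A, toLin (a * b) = toLin a * toLin b
  map_star : ∀ a : A, toLin (star a) = star (toLin a)
  bounded_sa : ∃ C : ℝ, ∀ a : selfAdjoint A, ‖toLin (a : A)‖ ≤ C * ‖(a : A)‖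

/-- The Gelfand transform `â` of `a`, as a function on `Δ*_bsa(A)`. -/
def gelfandHat {A : Type*} [NonUnitalNormedCommRing A] [StarRing A] [NormedSpace ℂ A] (a : A) :
    BsaCharacter A → ℂ :=
  fun τ => τ.toLin a

/-- `Δ*_bsa(A)` carries the weak* topology of the dual of the real normed space `A_sa`, that is, the
weakest topology making the evaluations at the elements of `A_sa` continuous. -/
noncomputable instance BsaCharacter.instTopologicalSpace (A : Type*) [NonUnitalNormedCommRing A] [StarRing A]
    [NormedSpace ℂ A] : TopologicalSpace (BsaCharacter A) :=
  TopologicalSpace.induced (fun τ (a : selfAdjoint A) => gelfandHat (a : A) τ) inferInstance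

/-- `Δ*_bsa(A)` carries its Borel sigma-algebra. -/
noncomputable instance BsaCharacter.instMeasurableSpace (A : Type*) [NonUnitalNormedCommRing A] [StarRing A]
    [NormedSpace ℂ A] : MeasurableSpace (BsaCharacter A) :=
  borel (BsaCharacter A)

/-- The set `M₁(Ω)` of inner regular Borel probability measures on `Ω`. Inner regularity means
`μ ω = sup {μ K : K ⊆ ω compact}` for every Borel set `ω`. -/
def M₁ (Ω : Type*) [TopologicalSpace Ω] [MeasurableSpace Ω] : Set (Measure Ω) :=
  {μ | IsProbabilityMeasure μ ∧ μ.InnerRegular}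

end AbstractBochner

/-!
Cauchy–Schwarz gives `|φ (b* a b)|² ≤ φ (b* b) φ (b* a² b)` for self-adjoint `a`, and iterated
squaring sharpens weak continuity to `|φ (b* a b)| ≤ φ (b* b) ‖a‖`. Hence `A` acts by bounded
operators on the Gelfand–Naimark–Segal space of a state `φ`, and finite variation provides a vector
`ξ` with `φ a = ⟪ξ, π a ξ⟫`. The C⋆-algebra generated by `π` is commutative, so the Gelfand and
Riesz–Markov–Kakutani theorems represent `φ` by a measure on its spectrum, whose points that do not
vanish on `A` are characters of `A`.

Conversely, the characters embed in a product of closed discs that also contains the zero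
functional. By Stone–Weierstrass, each continuous function on the product that vanishes at zero
restricts to a uniform limit of Gelfand transforms. Applied to Urysohn functions that are `1` on a
compact set of characters, this shows that the variation of `a ↦ ∫ â dμ` is the total mass of `μ`.
It also shows that the functional determines `μ`: the constants, missing from the Gelfand transforms
if `A` has no unit, are recovered from the mass.
-/

namespace AbstractBochner

open scoped InnerProductSpace CompactlySupported BoundedContinuousFunction
open Complex Topology UniformSpace Completion

section NormBound

lemma le_of_forall_pow_two_pow_le {x y C : ℝ} (hy : 0 ≤ y)
    (h : ∀ n : ℕ, x ^ 2 ^ n ≤ C * y ^ 2 ^ n) : x ≤ y := by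
  by_contra! hxy
  rcases hy.eq_or_lt with rfl | hy
  · have := h 0
    simp only [pow_zero, pow_one, mul_zero] at this
    exact absurd hxy this.not_gt
  · have one_lt_ratio : 1 < x / y := (one_lt_div hy).2 hxy
    obtain ⟨n, hn⟩ := pow_unbounded_of_one_lt C one_lt_ratio
    have : C < (x / y) ^ 2 ^ n :=
      hn.trans_le (pow_le_pow_right₀ one_lt_ratio.le n.lt_two_pow_self.le)
    rw [div_pow, lt_div_iff₀ (by positivity)] at this
    exact this.not_ge (h n)

lemma le_mul_norm_of_sq_le_mul_apply_mul_self {R : Type*} [NonUnitalSeminormedRing R] [StarRing R]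
    {f : R → ℝ} {K C : ℝ} (hK : 0 ≤ K)
    (hsq : ∀ a, IsSelfAdjoint a → f a ^ 2 ≤ K * f (a * a))
    (hC : ∀ a, IsSelfAdjoint a → f a ≤ C * ‖a‖) {a : R} (ha : IsSelfAdjoint a) :
    f a ≤ K * ‖a‖ := by
  have iterate (n : ℕ) : ∀ a, IsSelfAdjoint a → K * f a ^ 2 ^ n ≤ |C| * (K * ‖a‖) ^ 2 ^ n := by
    induction n with
    | zero =>
      intro a ha
      calc K * f a ^ 2 ^ 0 = K * f a := by rw [pow_zero, pow_one]
        _ ≤ K * (|C| * ‖a‖) := by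
          gcongr
          exact (hC a ha).trans (by gcongr; exact le_abs_self C)
        _ = |C| * (K * ‖a‖) ^ 2 ^ 0 := by ring
    | succ n ih =>
      intro a ha
      calc K * f a ^ 2 ^ (n + 1) = K * (f a ^ 2) ^ 2 ^ n := by rw [← pow_mul, pow_succ']
        _ ≤ K * (K * f (a * a)) ^ 2 ^ n := by gcongr; exact hsq a ha
        _ = K ^ 2 ^ n * (K * f (a * a) ^ 2 ^ n) := by ring
        _ ≤ K ^ 2 ^ n * (|C| * (K * (‖a‖ * ‖a‖)) ^ 2 ^ n) := by
          refine mul_le_mul_of_nonneg_left ?_ (by positivity)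
          exact (ih _ ((ha.commute_iff ha).1 (.refl a))).trans (by gcongr; exact norm_mul_le a a)
        _ = |C| * (K * ‖a‖) ^ 2 ^ (n + 1) := by
          rw [pow_succ' 2 n, pow_mul (K * ‖a‖)]; ring
  rcases hK.eq_or_lt with rfl | hK
  · have := hsq a ha
    rw [zero_mul] at this ⊢
    exact (pow_eq_zero_iff two_ne_zero).1 (this.antisymm (sq_nonneg _)) |>.le
  · refine le_of_forall_pow_two_pow_le (C := |C| / K) (by positivity) fun n ↦ ?_
    rw [div_mul_eq_mul_div, le_div_iff₀' hK]
    exact iterate n a ha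

end NormBound

section PositiveFunctional

variable {A : Type*} [NonUnitalNormedCommRing A] [StarRing A] [NormedSpace ℂ A]
  [IsScalarTower ℂ A A] [SMulCommClass ℂ A A] [StarModule ℂ A] {φ : A →ₗ[ℂ] ℂ}

lemma IsWeaklyContinuousOnSA.exists_norm_le (hφ : IsWeaklyContinuousOnSA φ) (b : A) :
    ∃ C : ℝ, ∀ a : A, IsSelfAdjoint a → ‖φ (star b * a * b)‖ ≤ C * ‖a‖ := by
  let conjugate : A →ₗ[ℂ] ℂ := φ ∘ₗ LinearMap.mulRight ℂ b ∘ₗ LinearMap.mulLeft ℂ (star b)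
  let restriction : selfAdjoint.submodule ℝ A →L[ℝ] ℂ :=
    ⟨conjugate.restrictScalars ℝ ∘ₗ (selfAdjoint.submodule ℝ A).subtype, hφ b⟩
  exact ⟨‖restriction‖, fun a ha ↦ restriction.le_opNorm ⟨a, ha⟩⟩

lemma IsPositive.conj_symm (hφ : IsPositive φ) (a b : A) :
    star (φ (star b * a)) = φ (star a * b) := by
  have im_eq_zero (c : A) : (φ (star c * c)).im = 0 := (Complex.nonneg_iff.1 (hφ c)).2.symm
  have polar_one := im_eq_zero (a + b)
  have polar_I := im_eq_zero (a + I • b)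
  simp only [star_add, add_mul, mul_add, map_add, star_smul, smul_mul_assoc, mul_smul_comm,
    map_smul, smul_eq_mul, add_im, mul_im, star_def, conj_I, neg_re, neg_im, I_re, I_im, mul_re,
    im_eq_zero a, im_eq_zero b] at polar_one polar_I
  apply Complex.ext
  · rw [star_def, conj_re]; linarith
  · rw [star_def, conj_im]; linarith

/-- The type synonym of `A` carrying the semi-inner product `⟪a, b⟫ = φ (a* b)` of a positive
linear functional `φ`; its completion is the Gelfand–Naimark–Segal space of `φ`. -/
@[nolint unusedArguments]
def PreGNS {φ : A →ₗ[ℂ] ℂ} (_ : IsPositive φ) : Type _ := A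

namespace PreGNS

variable (hφ : IsPositive φ)

noncomputable instance : AddCommGroup (PreGNS hφ) := inferInstanceAs (AddCommGroup A)
noncomputable instance : Module ℂ (PreGNS hφ) := inferInstanceAs (Module ℂ A)

/-- The identity map of `A`, read as a linear map from `A` to its Gelfand–Naimark–Segal
pre-inner product space. -/
def mk : A ≃ₗ[ℂ] PreGNS hφ := LinearEquiv.refl ℂ _

/-- The semi-inner product `⟪a, b⟫ = φ (a* b)`, from which the seminorm of `PreGNS hφ` is built. -/
noncomputable abbrev core : PreInnerProductSpace.Core ℂ (PreGNS hφ) where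
  inner a b := φ (star ((mk hφ).symm a) * (mk hφ).symm b)
  conj_inner_symm _ _ := hφ.conj_symm _ _
  re_inner_nonneg _ := (Complex.nonneg_iff.1 (hφ _)).1
  add_left _ _ _ := by rw [map_add, star_add, add_mul, map_add]
  smul_left _ _ _ := by rw [map_smul, star_smul, smul_mul_assoc, map_smul]; rfl

noncomputable instance : SeminormedAddCommGroup (PreGNS hφ) :=
  InnerProductSpace.Core.toSeminormedAddCommGroup (c := core hφ)
noncomputable instance : InnerProductSpace ℂ (PreGNS hφ) := InnerProductSpace.ofCore (core hφ)

lemma inner_mk (a b : A) : ⟪mk hφ a, mk hφ b⟫_ℂ = φ (star a * b) := rfl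

lemma norm_mk_sq (a : A) : ‖mk hφ a‖ ^ 2 = (φ (star a * a)).re := norm_sq_eq_re_inner (𝕜 := ℂ) _

end PreGNS

lemma IsPositive.norm_apply_star_mul_sq_le (hφ : IsPositive φ) (a b : A) :
    ‖φ (star a * b)‖ ^ 2 ≤ (φ (star a * a)).re * (φ (star b * b)).re := by
  rw [← PreGNS.inner_mk hφ, ← PreGNS.norm_mk_sq hφ, ← PreGNS.norm_mk_sq hφ, ← mul_pow]
  gcongr
  exact norm_inner_le_norm _ _

/- Cauchy–Schwarz gives `|φ (b* a b)|² ≤ φ (b* b) φ (b* a² b)`, so the crude bound from weak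
continuity improves to the sharp one by iterated squaring. -/
lemma IsPositive.norm_apply_conjugate_le (hφ : IsPositive φ) (hc : IsWeaklyContinuousOnSA φ)
    {a : A} (ha : IsSelfAdjoint a) (b : A) :
    ‖φ (star b * a * b)‖ ≤ (φ (star b * b)).re * ‖a‖ := by
  obtain ⟨C, hC⟩ := hc.exists_norm_le b
  refine le_mul_norm_of_sq_le_mul_apply_mul_self (f := fun a ↦ ‖φ (star b * a * b)‖)
    (Complex.nonneg_iff.1 (hφ b)).1 (fun a ha ↦ ?_) hC ha
  have square_eq : star (a * b) * (a * b) = star b * (a * a) * b := by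
    rw [star_mul, ha.star_eq]; simp only [mul_assoc]
  calc ‖φ (star b * a * b)‖ ^ 2 = ‖φ (star b * (a * b))‖ ^ 2 := by rw [mul_assoc]
    _ ≤ (φ (star b * b)).re * (φ (star (a * b) * (a * b))).re :=
      hφ.norm_apply_star_mul_sq_le b (a * b)
    _ ≤ (φ (star b * b)).re * ‖φ (star b * (a * a) * b)‖ := by
      rw [square_eq]
      gcongr
      · exact (Complex.nonneg_iff.1 (hφ b)).1
      · exact re_le_norm _

namespace PreGNS

variable (hφ : IsPositive φ)

lemma norm_mk_mul_le (hc : IsWeaklyContinuousOnSA φ) (a b : A) :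
    ‖mk hφ (a * b)‖ ≤ √‖star a * a‖ * ‖mk hφ b‖ := by
  refine (sq_le_sq₀ (by positivity) (by positivity)).1 ?_
  calc ‖mk hφ (a * b)‖ ^ 2 = (φ (star b * (star a * a) * b)).re := by
        rw [norm_mk_sq, star_mul]; simp only [mul_assoc]
    _ ≤ ‖φ (star b * (star a * a) * b)‖ := re_le_norm _
    _ ≤ (φ (star b * b)).re * ‖star a * a‖ :=
      hφ.norm_apply_conjugate_le hc (.star_mul_self a) b
    _ = (√‖star a * a‖ * ‖mk hφ b‖) ^ 2 := by
      rw [mul_pow, Real.sq_sqrt (norm_nonneg _), norm_mk_sq, mul_comm]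

/-- Left multiplication by `a`, as a bounded operator on `PreGNS hφ`; it extends to the operator
by which `a` acts on the completion. -/
noncomputable def leftMul (hc : IsWeaklyContinuousOnSA φ) (a : A) : PreGNS hφ →L[ℂ] PreGNS hφ :=
  ((mk hφ).toLinearMap ∘ₗ LinearMap.mulLeft ℂ a ∘ₗ (mk hφ).symm.toLinearMap).mkContinuous
    √‖star a * a‖ fun b ↦ norm_mk_mul_le hφ hc a ((mk hφ).symm b)

lemma leftMul_apply (hc : IsWeaklyContinuousOnSA φ) (a : A) (x : PreGNS hφ) :
    leftMul hφ hc a x = mk hφ (a * (mk hφ).symm x) := rfl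

lemma completion_leftMul_smul (hc : IsWeaklyContinuousOnSA φ) (c : ℂ) (a : A) :
    (leftMul hφ hc (c • a)).completion = c • (leftMul hφ hc a).completion := by
  ext x
  induction x using induction_on with
  | hp => exact isClosed_eq (by fun_prop) (c • (leftMul hφ hc a).completion).continuous
  | ih x => simp [leftMul_apply, smul_mul_assoc]

/-- The Gelfand–Naimark–Segal representation of `A` on the completion of `PreGNS hφ`. -/
noncomputable def rep (hc : IsWeaklyContinuousOnSA φ) :
    A →⋆ₙₐ[ℂ] (Completion (PreGNS hφ) →L[ℂ] Completion (PreGNS hφ)) where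
  toFun a := (leftMul hφ hc a).completion
  map_smul' := completion_leftMul_smul hφ hc
  map_zero' := by simpa using completion_leftMul_smul hφ hc 0 0
  map_add' a b := by
    ext x
    induction x using induction_on with
    | hp => apply isClosed_eq <;> fun_prop
    | ih x => simp [leftMul_apply, add_mul, Completion.coe_add]
  map_mul' a b := by
    ext x
    induction x using induction_on with
    | hp => apply isClosed_eq <;> fun_prop
    | ih x => simp [leftMul_apply, mul_assoc]
  map_star' a := by
    refine (ContinuousLinearMap.eq_adjoint_iff _ _).2 fun x y ↦ ?_
    induction x, y using induction_on₂ with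
    | hp => apply isClosed_eq <;> fun_prop
    | ih x y =>
      obtain ⟨x, rfl⟩ := (mk hφ).surjective x
      obtain ⟨y, rfl⟩ := (mk hφ).surjective y
      simp [leftMul_apply, inner_mk, mul_assoc, mul_left_comm]

lemma rep_mk (hc : IsWeaklyContinuousOnSA φ) (a b : A) :
    rep hφ hc a (mk hφ b : PreGNS hφ) = (mk hφ (a * b) : PreGNS hφ) :=
  ContinuousLinearMap.completion_apply_coe _ _

lemma norm_rep_le (hc : IsWeaklyContinuousOnSA φ) (a : A) :
    ‖rep hφ hc a‖ ≤ √‖star a * a‖ := by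
  refine ContinuousLinearMap.opNorm_le_bound _ (by positivity) fun x ↦ ?_
  induction x using induction_on with
  | hp => apply isClosed_le <;> fun_prop
  | ih x =>
    obtain ⟨x, rfl⟩ := (mk hφ).surjective x
    rw [rep_mk, norm_coe, norm_coe]
    exact norm_mk_mul_le hφ hc a x

lemma norm_rep_le_of_isSelfAdjoint (hc : IsWeaklyContinuousOnSA φ) {a : A}
    (ha : IsSelfAdjoint a) : ‖rep hφ hc a‖ ≤ ‖a‖ := by
  calc ‖rep hφ hc a‖ ≤ √‖star a * a‖ := norm_rep_le hφ hc a
    _ ≤ √(‖a‖ * ‖a‖) := by rw [ha.star_eq]; gcongr; exact norm_mul_le a a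
    _ = ‖a‖ := Real.sqrt_mul_self (norm_nonneg a)

variable {hφ} in
/-- A positive functional of finite variation is bounded for the seminorm `φ (a* a) ^ (1 / 2)`, so
it extends to the completion of `PreGNS hφ`. -/
noncomputable def functional (hv : HasFiniteVariation φ) : Completion (PreGNS hφ) →L[ℂ] ℂ :=
  ((φ ∘ₗ (mk hφ).symm.toLinearMap).mkContinuous √hv.some fun x ↦ by
    refine (sq_le_sq₀ (by positivity) (by positivity)).1 ?_
    obtain ⟨nonneg, le⟩ := hv.some_mem
    obtain ⟨a, rfl⟩ := (mk hφ).surjective x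
    rw [mul_pow, Real.sq_sqrt nonneg, norm_mk_sq]
    exact le a).fromCompletion

/-- The vector representing `φ` on the completion of `PreGNS hφ`. In the absence of a unit of `A`,
it takes the place of the class of `1`. -/
noncomputable def cyclicVector (hv : HasFiniteVariation φ) : Completion (PreGNS hφ) :=
  (InnerProductSpace.toDual ℂ _).symm (functional hv)

lemma inner_cyclicVector_mk (hv : HasFiniteVariation φ) (a : A) :
    ⟪cyclicVector hφ hv, (mk hφ a : PreGNS hφ)⟫_ℂ = φ a :=
  InnerProductSpace.toDual_symm_apply.trans (ContinuousLinearMap.fromCompletion_apply_coe _ _)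

lemma rep_cyclicVector (hc : IsWeaklyContinuousOnSA φ) (hv : HasFiniteVariation φ) (a : A) :
    rep hφ hc a (cyclicVector hφ hv) = (mk hφ a : PreGNS hφ) := by
  refine ext_inner_right ℂ fun x ↦ ?_
  induction x using induction_on with
  | hp => apply isClosed_eq <;> fun_prop
  | ih x =>
    obtain ⟨x, rfl⟩ := (mk hφ).surjective x
    rw [← ContinuousLinearMap.adjoint_inner_right, ← ContinuousLinearMap.star_eq_adjoint,
      ← map_star, rep_mk, inner_cyclicVector_mk, inner_coe, inner_mk]

lemma inner_cyclicVector_rep (hc : IsWeaklyContinuousOnSA φ) (hv : HasFiniteVariation φ) (a : A) :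
    ⟪cyclicVector hφ hv, rep hφ hc a (cyclicVector hφ hv)⟫_ℂ = φ a := by
  rw [rep_cyclicVector, inner_cyclicVector_mk]

end PreGNS

end PositiveFunctional

section RieszMarkovKakutani

variable {X : Type*} [TopologicalSpace X] {L : C(X, ℂ) →ₗ[ℂ] ℂ}

lemma apply_ofReal_nonneg (hL : ∀ f, 0 ≤ L (star f * f)) {g : C(X, ℝ)} (hg : 0 ≤ g) :
    0 ≤ L (ofRealCLM.compLeftContinuous ℝ X g) := by
  let root : C(X, ℂ) := ⟨fun x ↦ (√(g x) : ℂ), by fun_prop⟩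
  have eq_square : ofRealCLM.compLeftContinuous ℝ X g = star root * root := by
    ext x
    simpa [root, ← ofReal_mul] using (Real.mul_self_sqrt (hg x)).symm
  exact eq_square ▸ hL root

lemma ofReal_re_apply_ofReal (hL : ∀ f, 0 ≤ L (star f * f)) (g : C(X, ℝ)) :
    ((L (ofRealCLM.compLeftContinuous ℝ X g)).re : ℂ) = L (ofRealCLM.compLeftContinuous ℝ X g) := by
  have hpos := (Complex.nonneg_iff.1 (apply_ofReal_nonneg hL (posPart_nonneg g))).2
  have hneg := (Complex.nonneg_iff.1 (apply_ofReal_nonneg hL (negPart_nonneg g))).2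
  refine Complex.ext rfl ?_
  rw [ofReal_im, ← posPart_sub_negPart g, map_sub, map_sub, sub_im, ← hpos, ← hneg, sub_zero]

theorem exists_measure_eq_integral_continuousMap [CompactSpace X] [T2Space X] [MeasurableSpace X]
    [BorelSpace X] (hL : ∀ f, 0 ≤ L (star f * f)) :
    ∃ ν : Measure X, IsFiniteMeasure ν ∧ ν.InnerRegular ∧ ∀ f, L f = ∫ x, f x ∂ν := by
  let toComplex : C(X, ℝ) →L[ℝ] C(X, ℂ) := ofRealCLM.compLeftContinuous ℝ X
  let Λ : C_c(X, ℝ) →ₚ[ℝ] ℝ := PositiveLinearMap.mk₀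
    { toFun g := (L (toComplex g)).re
      map_add' g h := by
        rw [← add_re, ← map_add, ← map_add]; rfl
      map_smul' c g := by
        rw [RingHom.id_apply, smul_eq_mul, ← re_ofReal_mul, ← smul_eq_mul (c : ℂ), ← map_smul,
          Complex.coe_smul, ← map_smul]; rfl }
    fun g hg ↦ (Complex.nonneg_iff.1 (apply_ofReal_nonneg hL (g := g) hg)).1
  let ν := RealRMK.rieszMeasure Λ
  have apply_toComplex (g : C(X, ℝ)) : L (toComplex g) = ((∫ x, g x ∂ν : ℝ) : ℂ) := by
    rw [← ofReal_re_apply_ofReal hL]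
    exact congrArg _ (RealRMK.integral_rieszMeasure Λ ⟨g, .of_compactSpace _⟩).symm
  refine ⟨ν, inferInstance, inferInstance, fun f ↦ ?_⟩
  let realPart : C(X, ℝ) := ⟨fun x ↦ (f x).re, by fun_prop⟩
  let imagPart : C(X, ℝ) := ⟨fun x ↦ (f x).im, by fun_prop⟩
  have decomposition : f = toComplex realPart + I • toComplex imagPart := by
    ext x
    exact (re_add_im (f x)).symm.trans (by rw [mul_comm]; rfl)
  have hf : Integrable f ν :=
    f.continuous.integrable_of_hasCompactSupport (.of_compactSpace _)
  calc L f = (∫ x, (f x).re ∂ν : ℝ) + (∫ x, (f x).im ∂ν : ℝ) * I := by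
        conv_lhs => rw [decomposition]
        rw [map_add, map_smul, apply_toComplex, apply_toComplex, smul_eq_mul, mul_comm]
        rfl
    _ = ∫ x, f x ∂ν := integral_re_add_im hf

end RieszMarkovKakutani

section CStarRange

variable {A B : Type*} [NonUnitalCommSemiring A] [Star A] [Module ℂ A] [CStarAlgebra B]

/-- The unital C⋆-algebra generated by the range of a `*`-homomorphism into a C⋆-algebra. It is
commutative when the domain is. -/
noncomputable abbrev cstarRange (π : A →⋆ₙₐ[ℂ] B) : StarSubalgebra ℂ B :=
  (StarAlgebra.adjoin ℂ (Set.range π)).topologicalClosure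

lemma cstarRange_mul_comm (π : A →⋆ₙₐ[ℂ] B) (x y : cstarRange π) : x * y = y * x := by
  have isMulCommutative := StarAlgebra.isMulCommutative_adjoin ℂ (s := Set.range π)
    (by rintro _ ⟨a, rfl⟩ _ ⟨b, rfl⟩; rw [← map_mul, ← map_mul, mul_comm])
    (by rintro _ ⟨a, rfl⟩ _ ⟨b, rfl⟩; rw [← map_star, ← map_mul, ← map_mul, mul_comm])
  let := StarSubalgebra.commRingTopologicalClosure (StarAlgebra.adjoin ℂ (Set.range π))
    isMulCommutative.is_comm.comm
  exact mul_comm x y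

noncomputable instance (π : A →⋆ₙₐ[ℂ] B) : NormedCommRing (cstarRange π) where
  __ := SubringClass.toNormedRing (cstarRange π)
  mul_comm := cstarRange_mul_comm π

noncomputable instance (π : A →⋆ₙₐ[ℂ] B) : CommCStarAlgebra (cstarRange π) where
  complete := (StarSubalgebra.isClosed_topologicalClosure _).completeSpace_coe.complete

/-- A `*`-homomorphism, with its codomain restricted to the C⋆-algebra that it generates. -/
noncomputable def cstarRangeRestrict (π : A →⋆ₙₐ[ℂ] B) : A →⋆ₙₐ[ℂ] cstarRange π where
  toFun a := ⟨π a, StarSubalgebra.le_topologicalClosure _ (StarAlgebra.subset_adjoin ℂ _ ⟨a, rfl⟩)⟩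
  map_smul' c a := Subtype.ext (map_smul π c a)
  map_zero' := Subtype.ext (map_zero π)
  map_add' a b := Subtype.ext (map_add π a b)
  map_mul' a b := Subtype.ext (map_mul π a b)
  map_star' a := Subtype.ext (map_star π a)

end CStarRange

section GelfandHat

variable {A : Type*} [NonUnitalNormedCommRing A] [StarRing A] [NormedSpace ℂ A]

instance : BorelSpace (BsaCharacter A) := ⟨rfl⟩

lemma gelfandHat_add (a b : A) (τ : BsaCharacter A) :
    gelfandHat (a + b) τ = gelfandHat a τ + gelfandHat b τ := map_add τ.toLin a b

lemma gelfandHat_smul (c : ℂ) (a : A) (τ : BsaCharacter A) :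
    gelfandHat (c • a) τ = c * gelfandHat a τ := map_smul τ.toLin c a

lemma gelfandHat_mul (a b : A) (τ : BsaCharacter A) :
    gelfandHat (a * b) τ = gelfandHat a τ * gelfandHat b τ := τ.map_mul a b

lemma gelfandHat_star (a : A) (τ : BsaCharacter A) :
    gelfandHat (star a) τ = star (gelfandHat a τ) := τ.map_star a

lemma gelfandHat_star_mul_self (a : A) (τ : BsaCharacter A) :
    gelfandHat (star a * a) τ = ((‖gelfandHat a τ‖ ^ 2 : ℝ) : ℂ) := by
  rw [gelfandHat_mul, gelfandHat_star, star_def, conj_mul', ofReal_pow]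

lemma norm_gelfandHat_le_of_isSelfAdjoint {a : A} (ha : IsSelfAdjoint a) (τ : BsaCharacter A) :
    ‖gelfandHat a τ‖ ≤ ‖a‖ := by
  obtain ⟨C, hC⟩ := τ.bounded_sa
  simpa only [one_mul] using le_mul_norm_of_sq_le_mul_apply_mul_self
    (f := fun a ↦ ‖gelfandHat a τ‖) zero_le_one
    (fun a _ ↦ by rw [gelfandHat_mul, norm_mul, one_mul, sq]) (fun a ha ↦ hC ⟨a, ha⟩) ha

lemma norm_gelfandHat_le (a : A) (τ : BsaCharacter A) : ‖gelfandHat a τ‖ ≤ √‖star a * a‖ := by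
  refine Real.le_sqrt_of_sq_le ?_
  have := norm_gelfandHat_le_of_isSelfAdjoint (IsSelfAdjoint.star_mul_self a) τ
  rwa [gelfandHat_mul, gelfandHat_star, norm_mul, norm_star, ← sq] at this

lemma continuous_gelfandHat_of_isSelfAdjoint {a : A} (ha : IsSelfAdjoint a) :
    Continuous (gelfandHat a) :=
  (continuous_apply (A := fun _ : selfAdjoint A ↦ ℂ) ⟨a, ha⟩).comp (continuous_induced_dom
    (f := fun (τ : BsaCharacter A) (a : selfAdjoint A) ↦ gelfandHat (a : A) τ))

lemma continuous_gelfandHat [StarModule ℂ A] (a : A) : Continuous (gelfandHat a) := by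
  have decomposition : gelfandHat a = fun τ ↦
      gelfandHat (realPart a : A) τ + I * gelfandHat (imaginaryPart a : A) τ := by
    funext τ
    rw [← gelfandHat_smul, ← gelfandHat_add, realPart_add_I_smul_imaginaryPart]
  rw [decomposition]
  exact (continuous_gelfandHat_of_isSelfAdjoint (realPart a).2).add
    (continuous_const.mul (continuous_gelfandHat_of_isSelfAdjoint (imaginaryPart a).2))

lemma integrable_gelfandHat [StarModule ℂ A] (μ : Measure (BsaCharacter A)) [IsFiniteMeasure μ]
    (a : A) : Integrable (gelfandHat a) μ :=
  .of_bound (continuous_gelfandHat a).aestronglyMeasurable _ (.of_forall (norm_gelfandHat_le a))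

end GelfandHat

section SpectralMeasure

variable {A : Type*} [NonUnitalNormedCommRing A] [StarRing A] [NormedSpace ℂ A] {C : ℝ}

/-- Evaluation at a point `x`, as a character of a `*`-algebra represented by continuous functions
that do not all vanish at `x`. -/
noncomputable def BsaCharacter.ofPoint {X : Type*} [TopologicalSpace X] (e : A →⋆ₙₐ[ℂ] C(X, ℂ))
    (he : ∀ a, IsSelfAdjoint a → ∀ x, ‖e a x‖ ≤ C * ‖a‖) (x : X) (hx : ∃ a, e a x ≠ 0) :
    BsaCharacter A where
  toLin :=
    { toFun a := e a x
      map_add' a b := congrArg (fun f : C(X, ℂ) ↦ f x) (map_add e a b)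
      map_smul' c a := congrArg (fun f : C(X, ℂ) ↦ f x) (map_smul e c a) }
  ne_zero h := hx.elim fun a ha ↦ ha (LinearMap.congr_fun h a)
  map_mul a b := congrArg (fun f : C(X, ℂ) ↦ f x) (_root_.map_mul e a b)
  map_star a := congrArg (fun f : C(X, ℂ) ↦ f x) (StarHomClass.map_star e a)
  bounded_sa := ⟨C, fun a ↦ he a a.2 x⟩

/- The pushforward of `ν` is along the partial map `x ↦ ofPoint e he x`, which is defined off the
common zeros of the functions `e a`; these do not contribute to the integrals. -/
theorem exists_measure_integral_gelfandHat_of_continuousMap [StarModule ℂ A] {X : Type*}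
    [TopologicalSpace X] [MeasurableSpace X] [BorelSpace X] (ν : Measure X) [IsFiniteMeasure ν]
    [ν.InnerRegular] (e : A →⋆ₙₐ[ℂ] C(X, ℂ))
    (he : ∀ a, IsSelfAdjoint a → ∀ x, ‖e a x‖ ≤ C * ‖a‖) :
    ∃ μ : Measure (BsaCharacter A), IsFiniteMeasure μ ∧ μ.InnerRegular ∧
      ∀ a, ∫ x, e a x ∂ν = ∫ τ, gelfandHat a τ ∂μ := by
  let U : Set X := {x | ∃ a, e a x ≠ 0}
  have isOpen_U : IsOpen U := by
    simp only [U, Set.ofPred_exists]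
    exact isOpen_iUnion fun a ↦ isOpen_ne_fun (e a).continuous continuous_const
  let toCharacter : U → BsaCharacter A := fun x ↦ .ofPoint e he x x.2
  have continuous_toCharacter : Continuous toCharacter := continuous_induced_rng.2 <|
    continuous_pi fun a : selfAdjoint A ↦ (e (a : A)).continuous.comp continuous_subtype_val
  have innerRegular_comap : (ν.comap ((↑) : U → X)).InnerRegular :=
    .comap' ν isOpen_U.isOpenEmbedding_subtypeVal
  refine ⟨(ν.comap (↑)).map toCharacter, inferInstance,
    .map_of_continuous continuous_toCharacter, fun a ↦ ?_⟩
  calc ∫ x, e a x ∂ν = ∫ x in U, e a x ∂ν :=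
        (setIntegral_eq_integral_of_forall_compl_eq_zero fun x hx ↦
          not_not.1 fun h ↦ hx (Set.mem_ofPred.2 ⟨a, h⟩)).symm
    _ = ∫ x : U, gelfandHat a (toCharacter x) ∂(ν.comap (↑)) :=
      (integral_subtype_comap isOpen_U.measurableSet (e a)).symm
    _ = ∫ τ, gelfandHat a τ ∂((ν.comap (↑)).map toCharacter) :=
      (integral_map continuous_toCharacter.aemeasurable
        (continuous_gelfandHat a).aestronglyMeasurable).symm

theorem exists_measure_integral_gelfandHat_of_commCStarAlgebra [StarModule ℂ A] {B : Type*}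
    [CommCStarAlgebra B] {L : B →ₗ[ℂ] ℂ} (hL : ∀ b, 0 ≤ L (star b * b)) (π : A →⋆ₙₐ[ℂ] B)
    (hπ : ∀ a, IsSelfAdjoint a → ‖π a‖ ≤ C * ‖a‖) :
    ∃ μ : Measure (BsaCharacter A), IsFiniteMeasure μ ∧ μ.InnerRegular ∧
      ∀ a, L (π a) = ∫ τ, gelfandHat a τ ∂μ := by
  let _ : MeasurableSpace (WeakDual.characterSpace ℂ B) := borel _
  have : BorelSpace (WeakDual.characterSpace ℂ B) := ⟨rfl⟩
  let G := gelfandStarTransform B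
  let M : C(WeakDual.characterSpace ℂ B, ℂ) →ₗ[ℂ] ℂ := L ∘ₗ (G.symm : _ →ₗ[ℂ] B)
  obtain ⟨ν, _, _, hν⟩ := exists_measure_eq_integral_continuousMap (L := M) fun f ↦ by
    change 0 ≤ L (G.symm (star f * f))
    rw [map_mul, map_star]
    exact hL _
  let e : A →⋆ₙₐ[ℂ] C(WeakDual.characterSpace ℂ B, ℂ) := (G : B →⋆ₙₐ[ℂ] _).comp π
  have norm_e_le (a : A) (ha : IsSelfAdjoint a) (x) : ‖e a x‖ ≤ C * ‖a‖ :=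
    calc ‖e a x‖ ≤ ‖G (π a)‖ := (e a).norm_coe_le_norm x
      _ = ‖π a‖ := (gelfandTransform_isometry B).norm_map_of_map_zero (map_zero _) (π a)
      _ ≤ C * ‖a‖ := hπ a ha
  obtain ⟨μ, hfin, hreg, hμ⟩ := exists_measure_integral_gelfandHat_of_continuousMap ν e norm_e_le
  refine ⟨μ, hfin, hreg, fun a ↦ ?_⟩
  calc L (π a) = L (G.symm (G (π a))) := by rw [StarAlgEquiv.symm_apply_apply]
    _ = ∫ x, e a x ∂ν := hν (e a)
    _ = ∫ τ, gelfandHat a τ ∂μ := hμ a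

theorem exists_measure_integral_gelfandHat_of_cstarAlgebra [StarModule ℂ A] {B : Type*}
    [CStarAlgebra B] {L : B →ₗ[ℂ] ℂ} (hL : ∀ b, 0 ≤ L (star b * b)) (π : A →⋆ₙₐ[ℂ] B)
    (hπ : ∀ a, IsSelfAdjoint a → ‖π a‖ ≤ C * ‖a‖) :
    ∃ μ : Measure (BsaCharacter A), IsFiniteMeasure μ ∧ μ.InnerRegular ∧
      ∀ a, L (π a) = ∫ τ, gelfandHat a τ ∂μ :=
  exists_measure_integral_gelfandHat_of_commCStarAlgebra (B := cstarRange π)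
    (L := L ∘ₗ (cstarRange π).toSubalgebra.val.toLinearMap) (fun b ↦ hL b) (cstarRangeRestrict π) hπ

/-- The vector functional `T ↦ ⟪ξ, T ξ⟫` on the bounded operators of a Hilbert space. -/
noncomputable def vectorFunctional {H : Type*} [NormedAddCommGroup H] [InnerProductSpace ℂ H]
    (ξ : H) : (H →L[ℂ] H) →ₗ[ℂ] ℂ where
  toFun T := ⟪ξ, T ξ⟫_ℂ
  map_add' _ _ := inner_add_right _ _ _
  map_smul' _ _ := inner_smul_right _ _ _

lemma vectorFunctional_star_mul_self_nonneg {H : Type*} [NormedAddCommGroup H]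
    [InnerProductSpace ℂ H] [CompleteSpace H] (ξ : H) (T : H →L[ℂ] H) :
    0 ≤ vectorFunctional ξ (star T * T) := by
  have := Complex.zero_le_real.2 (sq_nonneg ‖T ξ‖)
  rw [ofReal_pow] at this
  exact this.trans_eq ((inner_self_eq_norm_sq_to_K (T ξ)).symm.trans
    (ContinuousLinearMap.adjoint_inner_right T ξ (T ξ)).symm)

theorem IsPositive.exists_measure_eq_integral_gelfandHat [IsScalarTower ℂ A A]
    [SMulCommClass ℂ A A] [StarModule ℂ A] {φ : A →ₗ[ℂ] ℂ} (hφ : IsPositive φ)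
    (hc : IsWeaklyContinuousOnSA φ) (hv : HasFiniteVariation φ) :
    ∃ μ : Measure (BsaCharacter A), IsFiniteMeasure μ ∧ μ.InnerRegular ∧
      ∀ a, φ a = ∫ τ, gelfandHat a τ ∂μ := by
  obtain ⟨μ, hfin, hreg, hμ⟩ := exists_measure_integral_gelfandHat_of_cstarAlgebra (C := 1)
    (vectorFunctional_star_mul_self_nonneg (PreGNS.cyclicVector hφ hv)) (PreGNS.rep hφ hc)
    fun a ha ↦ by rw [one_mul]; exact PreGNS.norm_rep_le_of_isSelfAdjoint hφ hc ha
  exact ⟨μ, hfin, hreg, fun a ↦ (PreGNS.inner_cyclicVector_rep hφ hc hv a).symm.trans (hμ a)⟩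

end SpectralMeasure

section IntegralInequalities

variable {X E : Type*} [MeasurableSpace X] [NormedAddCommGroup E] [NormedSpace ℝ E]

lemma norm_integral_sq_le_measureReal_univ_mul (μ : Measure X) [IsFiniteMeasure μ] {f : X → E}
    (hf : MemLp f 2 μ) : ‖∫ x, f x ∂μ‖ ^ 2 ≤ μ.real Set.univ * ∫ x, ‖f x‖ ^ 2 ∂μ := by
  have hölder := integral_mul_norm_le_Lp_mul_Lq (μ := μ) (g := fun _ ↦ (1 : ℝ))
    Real.HolderConjugate.two_two (f := fun x ↦ ‖f x‖) (by simpa using hf.norm) (memLp_const 1)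
  simp only [norm_norm, norm_one, mul_one, Real.rpow_two, one_pow, integral_const, smul_eq_mul,
    ← Real.sqrt_eq_rpow] at hölder
  calc ‖∫ x, f x ∂μ‖ ^ 2 ≤ (√(∫ x, ‖f x‖ ^ 2 ∂μ) * √(μ.real Set.univ)) ^ 2 := by
        gcongr
        exact (norm_integral_le_integral_norm f).trans hölder
    _ = μ.real Set.univ * ∫ x, ‖f x‖ ^ 2 ∂μ := by
      rw [mul_pow, Real.sq_sqrt (integral_nonneg fun x ↦ sq_nonneg _),
        Real.sq_sqrt measureReal_nonneg, mul_comm]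

lemma continuous_integral_boundedContinuousFunction [TopologicalSpace X] [OpensMeasurableSpace X]
    [SecondCountableTopology E] [MeasurableSpace E] [BorelSpace E] (μ : Measure X)
    [IsFiniteMeasure μ] : Continuous fun f : X →ᵇ E ↦ ∫ x, f x ∂μ :=
  AddMonoidHomClass.continuous_of_bound
    (AddMonoidHom.mk' (fun f : X →ᵇ E ↦ ∫ x, f x ∂μ) fun f g ↦
      integral_add (f.integrable μ) (g.integrable μ))
    (μ.real Set.univ) fun f ↦ f.norm_integral_le_mul_norm μ

end IntegralInequalities

section IntegralFunctional

variable {A : Type*} [NonUnitalNormedCommRing A] [StarRing A] [NormedSpace ℂ A] [StarModule ℂ A]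
  (μ : Measure (BsaCharacter A)) [IsFiniteMeasure μ]

/-- The linear functional `a ↦ ∫ â dμ` of a finite measure `μ` on the characters. -/
noncomputable def integralFunctional : A →ₗ[ℂ] ℂ where
  toFun a := ∫ τ, gelfandHat a τ ∂μ
  map_add' a b := by
    simp_rw [gelfandHat_add]
    exact integral_add (integrable_gelfandHat μ a) (integrable_gelfandHat μ b)
  map_smul' c a := by
    simp_rw [gelfandHat_smul]
    exact integral_const_mul c _

lemma integralFunctional_apply (a : A) :
    integralFunctional μ a = ∫ τ, gelfandHat a τ ∂μ := rfl

lemma integralFunctional_star_mul_self (a : A) :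
    integralFunctional μ (star a * a) = ((∫ τ, ‖gelfandHat a τ‖ ^ 2 ∂μ : ℝ) : ℂ) := by
  simp_rw [integralFunctional_apply, gelfandHat_star_mul_self]
  exact integral_ofReal

lemma isPositive_integralFunctional : IsPositive (integralFunctional μ) := fun a ↦ by
  rw [integralFunctional_star_mul_self]
  exact Complex.zero_le_real.2 (integral_nonneg fun τ ↦ sq_nonneg _)

lemma norm_integralFunctional_conjugate_le {a : A} (ha : IsSelfAdjoint a) (b : A) :
    ‖integralFunctional μ (star b * a * b)‖ ≤ ‖star b * b‖ * μ.real Set.univ * ‖a‖ := by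
  calc ‖integralFunctional μ (star b * a * b)‖ ≤ ‖star b * b‖ * ‖a‖ * μ.real Set.univ := by
        refine norm_integral_le_of_norm_le_const (.of_forall fun τ ↦ ?_)
        rw [mul_right_comm, gelfandHat_mul, norm_mul]
        gcongr
        · exact norm_gelfandHat_le_of_isSelfAdjoint (.star_mul_self b) τ
        · exact norm_gelfandHat_le_of_isSelfAdjoint ha τ
    _ = ‖star b * b‖ * μ.real Set.univ * ‖a‖ := mul_right_comm _ _ _

lemma isWeaklyContinuousOnSA_integralFunctional :
    IsWeaklyContinuousOnSA (integralFunctional μ) := fun b ↦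
  AddMonoidHomClass.continuous_of_bound
    (AddMonoidHom.mk' (fun a : selfAdjoint A ↦ integralFunctional μ (star b * a * b)) fun a c ↦ by
      rw [AddSubgroup.coe_add, mul_add, add_mul, map_add])
    _ fun a ↦ norm_integralFunctional_conjugate_le μ a.2 b

lemma measureReal_univ_mem_variationBounds :
    μ.real Set.univ ∈ variationBounds (integralFunctional μ) := by
  refine ⟨measureReal_nonneg, fun a ↦ ?_⟩
  rw [integralFunctional_star_mul_self, ofReal_re]
  exact norm_integral_sq_le_measureReal_univ_mul μ <|
    .of_bound (continuous_gelfandHat a).aestronglyMeasurable _ (.of_forall (norm_gelfandHat_le a))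

end IntegralFunctional

section DiscProduct

variable {A : Type*} [NonUnitalNormedCommRing A] [StarRing A]

/-- A compact space in which the characters of `A` embed, since a character maps a self-adjoint
element `a` into the closed disc of radius `‖a‖`. -/
abbrev DiscProduct (A : Type*) [NonUnitalNormedCommRing A] [StarRing A] : Type _ :=
  (a : selfAdjoint A) → Metric.closedBall (0 : ℂ) ‖(a : A)‖

instance : CompactSpace (DiscProduct A) :=
  have (a : selfAdjoint A) : CompactSpace (Metric.closedBall (0 : ℂ) ‖(a : A)‖) :=
    isCompact_iff_compactSpace.1 (isCompact_closedBall _ _)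
  inferInstance

noncomputable instance : MeasurableSpace (DiscProduct A) := borel _

instance : BorelSpace (DiscProduct A) := ⟨rfl⟩

/-- The point of the product of discs that corresponds to the zero functional. It plays the role of
the point at infinity in the one-point compactification of the spectrum. -/
def DiscProduct.origin : DiscProduct A := fun _ ↦ ⟨0, Metric.mem_closedBall_self (norm_nonneg _)⟩

variable [NormedSpace ℂ A]

/-- The embedding of the characters into a product of closed discs. -/
def BsaCharacter.toDiscProduct (τ : BsaCharacter A) : DiscProduct A := fun a ↦
  ⟨gelfandHat (a : A) τ,
    mem_closedBall_zero_iff.2 (norm_gelfandHat_le_of_isSelfAdjoint a.2 τ)⟩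

open BsaCharacter (toDiscProduct)

lemma continuous_toDiscProduct : Continuous (toDiscProduct (A := A)) :=
  continuous_pi fun a ↦ (continuous_gelfandHat_of_isSelfAdjoint a.2).subtype_mk _

lemma isInducing_toDiscProduct : IsInducing (toDiscProduct (A := A)) :=
  .of_comp (g := fun (y : DiscProduct A) (a : selfAdjoint A) ↦ (y a : ℂ))
    continuous_toDiscProduct (by fun_prop) ⟨rfl⟩

lemma exists_measurableSet_preimage_toDiscProduct {s : Set (BsaCharacter A)}
    (hs : MeasurableSet s) : ∃ t, MeasurableSet t ∧ toDiscProduct ⁻¹' t = s := by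
  have comap_eq : (borel (DiscProduct A)).comap toDiscProduct =
      BsaCharacter.instMeasurableSpace A := by
    rw [← borel_comap, ← isInducing_toDiscProduct.eq_induced]
    rfl
  rwa [← comap_eq] at hs

lemma toDiscProduct_ne_origin (τ : BsaCharacter A) : τ.toDiscProduct ≠ .origin := fun h ↦ by
  refine τ.ne_zero (LinearMap.ext fun a ↦ ?_)
  have apply_star_mul_self : gelfandHat (star a * a) τ = 0 :=
    congrArg Subtype.val (congrFun h ⟨star a * a, .star_mul_self a⟩)
  rw [gelfandHat_star_mul_self, ofReal_eq_zero] at apply_star_mul_self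
  exact norm_eq_zero.1 (pow_eq_zero_iff two_ne_zero |>.1 apply_star_mul_self)

/-- The continuous functions on the product of discs that restrict on the characters to a Gelfand
transform plus a constant, the constant being the value at the origin. -/
def gelfandSubalgebra [IsScalarTower ℂ A A] [SMulCommClass ℂ A A] :
    StarSubalgebra ℂ C(DiscProduct A, ℂ) where
  carrier := {f | ∃ a : A, ∀ τ : BsaCharacter A,
    f τ.toDiscProduct = gelfandHat a τ + f .origin}
  mul_mem' := by
    rintro f g ⟨a, hf⟩ ⟨b, hg⟩
    refine ⟨a * b + g .origin • a + f .origin • b, fun τ ↦ ?_⟩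
    rw [ContinuousMap.mul_apply, ContinuousMap.mul_apply, hf, hg, gelfandHat_add, gelfandHat_add,
      gelfandHat_mul, gelfandHat_smul, gelfandHat_smul]
    ring
  add_mem' := by
    rintro f g ⟨a, hf⟩ ⟨b, hg⟩
    refine ⟨a + b, fun τ ↦ ?_⟩
    rw [ContinuousMap.add_apply, ContinuousMap.add_apply, hf, hg, gelfandHat_add]
    ring
  algebraMap_mem' c := ⟨0, fun τ ↦ by
    rw [algebraMap_apply, algebraMap_apply, ← zero_smul ℂ (0 : A), gelfandHat_smul, zero_mul,
      zero_add]⟩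
  star_mem' := by
    rintro f ⟨a, hf⟩
    refine ⟨star a, fun τ ↦ ?_⟩
    rw [ContinuousMap.star_apply, ContinuousMap.star_apply, hf, gelfandHat_star, star_add]

lemma topologicalClosure_gelfandSubalgebra [IsScalarTower ℂ A A] [SMulCommClass ℂ A A] :
    (gelfandSubalgebra (A := A)).topologicalClosure = ⊤ := by
  refine ContinuousMap.starSubalgebra_topologicalClosure_eq_top_of_separatesPoints _
    fun y z hyz ↦ ?_
  obtain ⟨a, ha⟩ := Function.ne_iff.1 hyz
  refine ⟨_, ⟨⟨fun y ↦ (y a : ℂ), by fun_prop⟩, ⟨a, fun τ ↦ ?_⟩, rfl⟩, fun h ↦ ha (Subtype.ext h)⟩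
  exact (add_zero _).symm

/-- The restriction to the characters of a continuous function on the product of discs, normalized
by subtracting its value at the origin. -/
noncomputable def restrictToCharacters (f : C(DiscProduct A, ℂ)) : BsaCharacter A →ᵇ ℂ :=
  (BoundedContinuousFunction.mkOfCompact (f - .const _ (f .origin))).compContinuous
    ⟨toDiscProduct, continuous_toDiscProduct⟩

lemma restrictToCharacters_apply (f : C(DiscProduct A, ℂ)) (τ : BsaCharacter A) :
    restrictToCharacters f τ = f τ.toDiscProduct - f .origin := rfl

lemma continuous_restrictToCharacters : Continuous (restrictToCharacters (A := A)) :=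
  (BoundedContinuousFunction.continuous_compContinuous _).comp <|
    (ContinuousMap.isometryEquivBoundedOfCompact _ _).continuous.comp <|
      continuous_id.sub <|
        ContinuousMap.continuous_const'.comp (continuous_eval_const _)

variable [StarModule ℂ A]

/-- The Gelfand transform of `a`, as an element of the Banach space of bounded continuous functions
on the characters. -/
noncomputable def boundedGelfandHat (a : A) : BsaCharacter A →ᵇ ℂ :=
  .ofNormedAddCommGroup (gelfandHat a) (continuous_gelfandHat a) _ (norm_gelfandHat_le a)

lemma restrictToCharacters_mem_closure_range [IsScalarTower ℂ A A] [SMulCommClass ℂ A A]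
    (f : C(DiscProduct A, ℂ)) :
    restrictToCharacters f ∈ closure (Set.range (boundedGelfandHat (A := A))) := by
  have hf : f ∈ (gelfandSubalgebra (A := A)).topologicalClosure :=
    (topologicalClosure_gelfandSubalgebra (A := A)) ▸ StarSubalgebra.mem_top
  refine map_mem_closure continuous_restrictToCharacters hf ?_
  rintro g ⟨a, hg⟩
  refine ⟨a, BoundedContinuousFunction.ext fun τ ↦ ?_⟩
  rw [restrictToCharacters_apply, hg, add_sub_cancel_right]
  rfl

end DiscProduct

section Variation

open BsaCharacter (toDiscProduct)

variable {A : Type*} [NonUnitalNormedCommRing A] [StarRing A] [NormedSpace ℂ A] [StarModule ℂ A]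
  {μ : Measure (BsaCharacter A)} [IsFiniteMeasure μ] {v : ℝ}

lemma norm_integral_sq_le_of_mem_closure_range (hv : v ∈ variationBounds (integralFunctional μ))
    {g : BsaCharacter A →ᵇ ℂ} (hg : g ∈ closure (Set.range (boundedGelfandHat (A := A)))) :
    ‖∫ τ, g τ ∂μ‖ ^ 2 ≤ v * (∫ τ, (star g * g) τ ∂μ).re := by
  have continuous_integral := continuous_integral_boundedContinuousFunction (E := ℂ) μ
  refine closure_minimal (t := {g : BsaCharacter A →ᵇ ℂ |
    ‖∫ τ, g τ ∂μ‖ ^ 2 ≤ v * (∫ τ, (star g * g) τ ∂μ).re}) ?_ (isClosed_le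
      (continuous_integral.norm.pow 2) (continuous_const.mul <| continuous_re.comp <|
        continuous_integral.comp (continuous_star.mul continuous_id))) hg
  rintro _ ⟨a, rfl⟩
  have star_mul_self : ⇑(star (boundedGelfandHat a) * boundedGelfandHat a) =
      gelfandHat (star a * a) := by
    funext τ
    rw [gelfandHat_mul, gelfandHat_star]
    rfl
  rw [Set.mem_ofPred_eq, star_mul_self]
  exact hv.2 a

lemma measureReal_le_of_isCompact [IsScalarTower ℂ A A] [SMulCommClass ℂ A A]
    (hv : v ∈ variationBounds (integralFunctional μ)) {K : Set (BsaCharacter A)}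
    (hK : IsCompact K) : μ.real K ≤ v := by
  obtain ⟨h, h_origin, h_K, h_mem⟩ := exists_continuous_zero_one_of_isClosed
    (isClosed_singleton (x := DiscProduct.origin (A := A)))
    (hK.image continuous_toDiscProduct).isClosed
    (Set.disjoint_singleton_left.2 fun ⟨τ, _, hτ⟩ ↦ toDiscProduct_ne_origin τ hτ)
  let u : BsaCharacter A →ᵇ ℝ := (BoundedContinuousFunction.mkOfCompact h).compContinuous
    ⟨toDiscProduct, continuous_toDiscProduct⟩
  let hc : C(DiscProduct A, ℂ) := ⟨fun y ↦ h y, by fun_prop⟩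
  have restrict_hc (τ : BsaCharacter A) : restrictToCharacters hc τ = u τ := by
    change (h τ.toDiscProduct : ℂ) - (h .origin : ℂ) = h τ.toDiscProduct
    rw [h_origin rfl, Pi.zero_apply, ofReal_zero, sub_zero]
  have measure_le : μ.real K ≤ ∫ τ, u τ ∂μ :=
    calc μ.real K ≤ μ.real {τ | 1 ≤ u τ} :=
          measureReal_mono fun τ hτ ↦ (h_K ⟨τ, hτ, rfl⟩).ge
      _ = 1 * μ.real {τ | 1 ≤ u τ} := (one_mul _).symm
      _ ≤ ∫ τ, u τ ∂μ := mul_meas_ge_le_integral_of_nonneg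
        (.of_forall fun τ ↦ (h_mem (toDiscProduct τ)).1) (u.integrable μ) 1
  have sq_le : (∫ τ, u τ ∂μ) ^ 2 ≤ v * ∫ τ, u τ * u τ ∂μ := by
    have := norm_integral_sq_le_of_mem_closure_range hv (restrictToCharacters_mem_closure_range hc)
    simpa only [BoundedContinuousFunction.mul_apply, BoundedContinuousFunction.star_apply,
      restrict_hc, star_def, conj_ofReal, ← ofReal_mul, integral_complex_ofReal, ofReal_re,
      norm_real, Real.norm_eq_abs, sq_abs] using this
  have integral_mul_le : ∫ τ, u τ * u τ ∂μ ≤ ∫ τ, u τ ∂μ :=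
    integral_mono ((u * u).integrable μ) (u.integrable μ) fun τ ↦
      mul_le_of_le_one_left (h_mem τ.toDiscProduct).1 (h_mem τ.toDiscProduct).2
  nlinarith [mul_le_mul_of_nonneg_left integral_mul_le hv.1, hv.1]

variable [IsScalarTower ℂ A A] [SMulCommClass ℂ A A]

theorem variation_integralFunctional [μ.InnerRegular] :
    variation (integralFunctional μ) = μ.real Set.univ := by
  refine IsLeast.csInf_eq ⟨measureReal_univ_mem_variationBounds μ, fun v hv ↦ ?_⟩
  refine ENNReal.toReal_le_of_le_ofReal hv.1 ?_
  rw [MeasurableSet.univ.measure_eq_iSup_isCompact]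
  exact iSup₂_le fun K _ ↦ iSup_le fun hK ↦ (ENNReal.le_ofReal_iff_toReal_le
    (measure_ne_top μ K) hv.1).2 (measureReal_le_of_isCompact hv hK)

end Variation

section Uniqueness

open BsaCharacter (toDiscProduct)

variable {A : Type*} [NonUnitalNormedCommRing A] [StarRing A] [NormedSpace ℂ A] [StarModule ℂ A]
  [IsScalarTower ℂ A A] [SMulCommClass ℂ A A] {μ ν : Measure (BsaCharacter A)}
  [IsFiniteMeasure μ] [IsFiniteMeasure ν]

lemma integral_restrictToCharacters_eq (h : integralFunctional μ = integralFunctional ν)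
    (f : C(DiscProduct A, ℂ)) :
    ∫ τ, restrictToCharacters f τ ∂μ = ∫ τ, restrictToCharacters f τ ∂ν := by
  refine closure_minimal (t := {g : BsaCharacter A →ᵇ ℂ | ∫ τ, g τ ∂μ = ∫ τ, g τ ∂ν}) ?_
    (isClosed_eq (continuous_integral_boundedContinuousFunction μ)
      (continuous_integral_boundedContinuousFunction ν)) (restrictToCharacters_mem_closure_range f)
  rintro _ ⟨a, rfl⟩
  exact LinearMap.congr_fun h a

variable [μ.InnerRegular] [ν.InnerRegular]

lemma integral_comp_toDiscProduct_eq (h : integralFunctional μ = integralFunctional ν)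
    (f : C(DiscProduct A, ℂ)) : ∫ τ, f (toDiscProduct τ) ∂μ = ∫ τ, f (toDiscProduct τ) ∂ν := by
  have mass_eq : μ.real Set.univ = ν.real Set.univ := by
    rw [← variation_integralFunctional, h, variation_integralFunctional]
  have decomposition (τ : BsaCharacter A) :
      f τ.toDiscProduct = restrictToCharacters f τ + f .origin :=
    (sub_add_cancel _ _).symm
  simp only [decomposition]
  rw [integral_add ((restrictToCharacters f).integrable μ) (integrable_const _),
    integral_add ((restrictToCharacters f).integrable ν) (integrable_const _), integral_const,
    integral_const, mass_eq, integral_restrictToCharacters_eq h]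

theorem measure_eq_of_integralFunctional_eq (h : integralFunctional μ = integralFunctional ν) :
    μ = ν := by
  have regular_μ : (μ.map toDiscProduct).InnerRegular := .map_of_continuous continuous_toDiscProduct
  have regular_ν : (ν.map toDiscProduct).InnerRegular := .map_of_continuous continuous_toDiscProduct
  have map_eq : μ.map toDiscProduct = ν.map toDiscProduct := by
    refine Measure.ext_of_integral_eq_on_compactlySupported fun f ↦ ?_
    have hf (κ : Measure (DiscProduct A)) : AEStronglyMeasurable f κ :=
      (map_continuous f).aestronglyMeasurable
    rw [integral_map continuous_toDiscProduct.aemeasurable (hf _),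
      integral_map continuous_toDiscProduct.aemeasurable (hf _)]
    have := integral_comp_toDiscProduct_eq h ⟨fun y ↦ (f y : ℂ), by fun_prop⟩
    simpa only [ContinuousMap.coe_mk, integral_complex_ofReal, ofReal_inj] using this
  ext s hs
  obtain ⟨t, ht, rfl⟩ := exists_measurableSet_preimage_toDiscProduct hs
  rw [← Measure.map_apply continuous_toDiscProduct.measurable ht, map_eq,
    Measure.map_apply continuous_toDiscProduct.measurable ht]

end Uniqueness

section States

variable {A : Type*} [NonUnitalNormedCommRing A] [StarRing A] [NormedSpace ℂ A] [StarModule ℂ A]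

instance (μ : M₁ (BsaCharacter A)) : IsProbabilityMeasure (μ : Measure (BsaCharacter A)) := μ.2.1

instance (μ : M₁ (BsaCharacter A)) : (μ : Measure (BsaCharacter A)).InnerRegular := μ.2.2

lemma integralFunctional_smul_add_smul (μ ν : Measure (BsaCharacter A)) [IsFiniteMeasure μ]
    [IsFiniteMeasure ν] (s t : ℝ≥0) :
    integralFunctional (s • μ + t • ν) =
      ((s : ℝ) : ℂ) • integralFunctional μ + ((t : ℝ) : ℂ) • integralFunctional ν := by
  ext a
  simp only [LinearMap.add_apply, LinearMap.smul_apply, integralFunctional_apply]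
  rw [integral_add_measure (integrable_gelfandHat μ a).smul_measure_nnreal
    (integrable_gelfandHat ν a).smul_measure_nnreal, integral_smul_nnreal_measure,
    integral_smul_nnreal_measure]
  rfl

variable [IsScalarTower ℂ A A] [SMulCommClass ℂ A A]

lemma integralFunctional_mem_States (μ : Measure (BsaCharacter A)) [IsProbabilityMeasure μ]
    [μ.InnerRegular] : integralFunctional μ ∈ States A :=
  ⟨isPositive_integralFunctional μ, isWeaklyContinuousOnSA_integralFunctional μ,
    ⟨_, measureReal_univ_mem_variationBounds μ⟩,
    variation_integralFunctional.trans probReal_univ⟩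

lemma exists_integralFunctional_eq_of_mem_States {φ : A →ₗ[ℂ] ℂ} (hφ : φ ∈ States A) :
    ∃ μ : M₁ (BsaCharacter A), integralFunctional (μ : Measure (BsaCharacter A)) = φ := by
  obtain ⟨positive, weaklyContinuous, finiteVariation, variation_eq_one⟩ := hφ
  obtain ⟨μ, _, regular, hμ⟩ :=
    positive.exists_measure_eq_integral_gelfandHat weaklyContinuous finiteVariation
  obtain rfl : φ = integralFunctional μ := LinearMap.ext hμ
  rw [variation_integralFunctional] at variation_eq_one
  exact ⟨⟨μ, isProbabilityMeasure_iff_real.2 variation_eq_one, regular⟩, rfl⟩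

/-- The bijection `μ ↦ ∫ â dμ` between the inner regular probability measures on the characters and
the states. -/
noncomputable def measureEquivStates : M₁ (BsaCharacter A) ≃ States A :=
  .ofBijective
    (fun μ ↦ ⟨integralFunctional (μ : Measure (BsaCharacter A)), integralFunctional_mem_States _⟩)
    ⟨fun _ _ h ↦ Subtype.ext (measure_eq_of_integralFunctional_eq (congrArg Subtype.val h)),
      fun φ ↦ (exists_integralFunctional_eq_of_mem_States φ.2).imp fun _ ↦ Subtype.ext⟩

lemma coe_measureEquivStates (μ : M₁ (BsaCharacter A)) :
    (measureEquivStates μ : A →ₗ[ℂ] ℂ) = integralFunctional (μ : Measure (BsaCharacter A)) := rfl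

end States

lemma convexComb_mem_M₁ {Ω : Type*} [TopologicalSpace Ω] [MeasurableSpace Ω] {μ ν : Measure Ω}
    (hμ : μ ∈ M₁ Ω) (hν : ν ∈ M₁ Ω) {s t : ℝ≥0} (hst : s + t = 1) : s • μ + t • ν ∈ M₁ Ω := by
  obtain ⟨_, _⟩ := hμ
  obtain ⟨_, _⟩ := hν
  refine ⟨⟨?_⟩, inferInstance⟩
  simp only [Measure.add_apply, Measure.smul_apply, measure_univ, ENNReal.smul_def, smul_eq_mul,
    mul_one]
  exact_mod_cast hst

end AbstractBochner

theorem mainTheorem7 (A : Type*) [NonUnitalNormedCommRing A] [StarRing A] [NormedSpace ℂ A]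
    [IsScalarTower ℂ A A] [SMulCommClass ℂ A A] [StarModule ℂ A] :
    ∃ Φ : AbstractBochner.M₁ (AbstractBochner.BsaCharacter A) ≃ AbstractBochner.States A,
      (∀ (μ : AbstractBochner.M₁ (AbstractBochner.BsaCharacter A)) (a : A),
        Integrable (AbstractBochner.gelfandHat a) (μ : Measure (AbstractBochner.BsaCharacter A)) ∧
        (Φ μ : A →ₗ[ℂ] ℂ) a =
          ∫ τ, AbstractBochner.gelfandHat a τ ∂(μ : Measure (AbstractBochner.BsaCharacter A))) ∧
      (∀ (μ₁ μ₂ : AbstractBochner.M₁ (AbstractBochner.BsaCharacter A)) (s t : ℝ≥0), s + t = 1 →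
        ∃ μ : AbstractBochner.M₁ (AbstractBochner.BsaCharacter A),
          (μ : Measure (AbstractBochner.BsaCharacter A)) =
            s • (μ₁ : Measure (AbstractBochner.BsaCharacter A)) +
              t • (μ₂ : Measure (AbstractBochner.BsaCharacter A)) ∧
          (Φ μ : A →ₗ[ℂ] ℂ) =
            ((s : ℝ) : ℂ) • (Φ μ₁ : A →ₗ[ℂ] ℂ) + ((t : ℝ) : ℂ) • (Φ μ₂ : A →ₗ[ℂ] ℂ)) := by
  refine ⟨AbstractBochner.measureEquivStates,
    fun μ a ↦ ⟨AbstractBochner.integrable_gelfandHat _ a, rfl⟩, fun μ₁ μ₂ s t hst ↦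
      ⟨⟨_, AbstractBochner.convexComb_mem_M₁ μ₁.2 μ₂.2 hst⟩, rfl, ?_⟩⟩
  simp only [AbstractBochner.coe_measureEquivStates]
  exact AbstractBochner.integralFunctional_smul_add_smul _ _ s t
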